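/- Let $n\ge 0$ be an integer. For $j\ge 0$ let $C(n,j)$ be the set of $j$-element subsets of $\{1,\dots,n\}$, ordered lexicographically, and for $X\in C(n,j+1)$ let the $j$-packet $P_X$ be the set of all $j$-element subsets of $X$. For $j\geq 1$ an admissible $j$-order is a total order $\rho$ on $C(n,j)$ that induces the lexicographic or the antilexicographic (reverse lexicographic) order on every $j$-packet; its inversion set $\operatorname{Inv}(\rho)$ is the set of $X\in C(n,j+1)$ such that $\rho$ is antilexicographic on $P_X$. Let $B(n,j)$ be the set of admissible $j$-orders modulo the equivalence relation generated by interchanging two neighbouring elements that do not lie in a common $j$-packet (the result again being an admissible $j$-order); $\operatorname{Inv}$ is well defined on $B(n,j)$. For $r,r'\in B(n,j)$ write $r\xrightarrow{X}r'$ if $X\in C(n,j+1)\setminus\operatorname{Inv}(r)$ and some representative $\rho$ of $r$, in which $P_X$ is a contiguous block, becomes a representative of $r'$ when this block is reversed. A path from $K$ to $L$ in $B(n,j)$, for $K,L\subseteq C(n,j+1)$, is a sequence $r_0\to r_1\to\cdots\to r_m$ ($m\ge 0$) of such steps with $\operatorname{Inv}(r_0)=K$ and $\operatorname{Inv}(r_m)=L$.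 A set $J\subseteq C(n,k)$ is a realizable $k$-set if for every $X\in C(n,k+1)$ the set $P_X\cap J$ is a (possibly empty) initial or final segment of $P_X$ in the lexicographic order. Let $J_p$, $J_s$ and $J_F$ be the sets of those $X\in C(n,k+1)$ for which $P_X\cap J$ is, respectively, a non-empty proper initial segment of $P_X$, a non-empty proper final segment of $P_X$, and all of $P_X$. An admissible $J$-order is a total order on $J$ that induces the antilexicographic order on $P_X\cap J$ for every $X\in J_s$, the lexicographic order on $P_X\cap J$ for every $X\in J_p$, and the lexicographic or the antilexicographic order on $P_X$ for every $X\in J_F$. **Theorem.** Let $k>1$ and let $J$ be a realizable $k$-set. Each path $r_0\xrightarrow{X_1}r_1\xrightarrow{X_2}\cdots\xrightarrow{X_m}r_m$ from $\emptyset$ to $J$ in $B(n,k-1)$ has uniquely determined labels $X_1,\dots,X_m$, and sending it to the order $X_1<X_2<\cdots<X_m$ defines a bijection from the set of paths from $\emptyset$ to $J$ in $B(n,k-1)$ onto the set of admissible $J$-orders. -/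

import Mathlib

/-!
The ground set `{1, …, n}` is modelled by `Fin n` with its usual order, and a `k`-set is a
`Finset (Fin n)` with `k` elements. A total order `X₁ < X₂ < ⋯ < X_m` on a finite set is
represented by its increasing enumeration, the list `[X₁, X₂, …, X_m]`.
-/

namespace HigherBruhat

/-- `C(n,k)`: the collection of all `k`-element subsets of the ground set. -/
def C (n k : ℕ) : Finset (Finset (Fin n)) :=
  (Finset.univ : Finset (Fin n)).powersetCard k

/-- The packet `P_X` of a `(k+1)`-set `X`: the collection of all `k`-sets contained in `X`. -/
def packet {n : ℕ} (k : ℕ) (X : Finset (Fin n)) : Finset (Finset (Fin n)) :=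
  X.powersetCard k

/-- The strict lexicographic order on sets of equal size: `A` comes before `B` when the smallest
element at which the two sets differ belongs to `A`. -/
def LexLT {n : ℕ} (A B : Finset (Fin n)) : Prop :=
  ∃ a, a ∈ A ∧ a ∉ B ∧ ∀ b, b < a → (b ∈ A ↔ b ∈ B)

/-- The list `ρ` is (the increasing enumeration of) a total order on the finite set `S`. -/
def IsTotalOrderOn {α : Type*} (ρ : List α) (S : Finset α) : Prop :=
  ρ.Nodup ∧ ∀ A, A ∈ ρ ↔ A ∈ S

/-- The total order `ρ` induces the lexicographic order on the members of `P` that it orders. -/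
def InducesLex {n : ℕ} (ρ : List (Finset (Fin n))) (P : Finset (Finset (Fin n))) : Prop :=
  (ρ.filter (· ∈ P)).Pairwise (fun A B => LexLT A B)

/-- The total order `ρ` induces the antilexicographic order on the members of `P` that it
orders. -/
def InducesAntilex {n : ℕ} (ρ : List (Finset (Fin n))) (P : Finset (Finset (Fin n))) : Prop :=
  (ρ.filter (· ∈ P)).Pairwise (fun A B => LexLT B A)

/-- `A(n,k)`: the admissible `k`-orders, that is, the total orders on `C(n,k)` that induce the
lexicographic or the antilexicographic order on every `k`-packet. -/
def A (n k : ℕ) : Set (List (Finset (Fin n))) :=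
  {ρ | IsTotalOrderOn ρ (C n k) ∧
    ∀ X ∈ C n (k + 1), InducesLex ρ (packet k X) ∨ InducesAntilex ρ (packet k X)}

open Classical in
/-- The inversion set of an admissible `k`-order: the `(k+1)`-sets `X` such that the order
induced on the packet of `X` is antilexicographic. -/
noncomputable def invOrder {n : ℕ} (k : ℕ) (ρ : List (Finset (Fin n))) :
    Finset (Finset (Fin n)) :=
  (C n (k + 1)).filter (fun X => InducesAntilex ρ (packet k X))

/-- Two admissible `k`-orders are elementary equivalent if they differ by an interchange of two
neighbours that do not lie in a common `k`-packet. -/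
def ElemEquiv {n k : ℕ} (ρ ρ' : A n k) : Prop :=
  ∃ (l₁ l₂ : List (Finset (Fin n))) (U V : Finset (Fin n)),
    ρ.1 = l₁ ++ U :: V :: l₂ ∧ ρ'.1 = l₁ ++ V :: U :: l₂ ∧
    ¬ ∃ X ∈ C n (k + 1), U ∈ packet k X ∧ V ∈ packet k X

/-- `B(n,k)`: the quotient of `A(n,k)` by the equivalence relation generated by the elementary
equivalences. -/
def B (n k : ℕ) : Type := Quot (ElemEquiv (n := n) (k := k))

theorem invOrder_eq_of_elemEquiv {n k : ℕ} (ρ ρ' : A n k) (h : ElemEquiv ρ ρ') :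
    invOrder k ρ.1 = invOrder k ρ'.1 := by
  obtain ⟨l₁, l₂, U, V, h₁, h₂, hUV⟩ := h
  classical
  unfold invOrder
  ext X
  simp only [Finset.mem_filter]
  refine and_congr_right fun hX => ?_
  have key : ρ.1.filter (· ∈ packet k X) = ρ'.1.filter (· ∈ packet k X) := by
    rw [h₁, h₂]
    by_cases hU : U ∈ packet k X <;> by_cases hV : V ∈ packet k X
    · exact absurd ⟨X, hX, hU, hV⟩ hUV
    all_goals simp [List.filter_append, hU, hV]
  unfold InducesAntilex
  rw [key]

/-- The inversion set of an element of `B(n,k)`: the inversion set of any representative. -/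
noncomputable def Inv {n k : ℕ} : B n k → Finset (Finset (Fin n)) :=
  Quot.lift (fun ρ => invOrder k ρ.1) invOrder_eq_of_elemEquiv

/-- The packet of `X` forms a contiguous block in `ρ`, and `ρ'` arises from `ρ` by reversing
this block: `X ∈ N(ρ)` and `ρ' = p_X(ρ)`. -/
def PacketFlip {n : ℕ} (k : ℕ) (X : Finset (Fin n)) (ρ ρ' : List (Finset (Fin n))) : Prop :=
  ∃ l₁ c l₂ : List (Finset (Fin n)),
    ρ = l₁ ++ c ++ l₂ ∧ ρ' = l₁ ++ c.reverse ++ l₂ ∧ ∀ U, U ∈ c ↔ U ∈ packet k X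

/-- The arrow `r → r'` labelled `X` in `B(n,k)`: `X ∈ N(r) ∖ Inv(r)` and `r' = p_X(r)`, where
packet flips of classes are computed on representatives in which the packet is a block. -/
def FlipUp {n k : ℕ} (r : B n k) (X : Finset (Fin n)) (r' : B n k) : Prop :=
  X ∈ C n (k + 1) ∧ X ∉ Inv r ∧
    ∃ ρ ρ' : A n k, Quot.mk _ ρ = r ∧ Quot.mk _ ρ' = r' ∧ PacketFlip k X ρ.1 ρ'.1

/-- The edge relation of the graph `B(n,k)`. -/
def Step (n k : ℕ) : SetRel (B n k) (B n k) :=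
  {p | ∃ X, FlipUp p.1 X p.2}

/-- The paths `r₀ → r₁ → ⋯ → r_m` in `B(n,k)` from `K` to `L`, where collections of `(k+1)`-sets
stand for the elements of `B(n,k)` of which they are the inversion sets. -/
def Paths (n k : ℕ) (K L : Finset (Finset (Fin n))) : Type :=
  {γ : RelSeries (Step n k) // Inv γ.head = K ∧ Inv γ.last = L}

/-- The sequence of labels along the path `γ` is `ρ`: if `ρ = [X₁, …, X_m]`, then `γ` is
`r₀ → r₁ → ⋯ → r_m` with `r_{i-1} → r_i` labelled `X_i`. -/
def HasLabels {n k : ℕ} (γ : RelSeries (Step n k)) (ρ : List (Finset (Fin n))) : Prop :=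
  ∃ h : γ.length = ρ.length,
    ∀ i : Fin γ.length, FlipUp (γ i.castSucc) (ρ.get (i.cast h)) (γ i.succ)

/-- `S` is a (possibly empty) initial segment of the packet `P` in its lexicographic order. -/
def IsPrefix {n : ℕ} (S P : Finset (Finset (Fin n))) : Prop :=
  S ⊆ P ∧ ∀ U ∈ P, ∀ V ∈ S, LexLT U V → U ∈ S

/-- `S` is a (possibly empty) final segment of the packet `P` in its lexicographic order. -/
def IsSuffix {n : ℕ} (S P : Finset (Finset (Fin n))) : Prop :=
  S ⊆ P ∧ ∀ U ∈ P, ∀ V ∈ S, LexLT V U → U ∈ S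

/-- A realizable `k`-set: a collection `J` of `k`-sets that meets every `k`-packet in a prefix or
a suffix of the packet. -/
def Realizable {n : ℕ} (k : ℕ) (J : Finset (Finset (Fin n))) : Prop :=
  J ⊆ C n k ∧ ∀ X ∈ C n (k + 1),
    IsPrefix (packet k X ∩ J) (packet k X) ∨ IsSuffix (packet k X ∩ J) (packet k X)

/-- `J_p`: the `(k+1)`-sets whose packet meets `J` in a proper non-empty prefix. -/
def Jp {n : ℕ} (k : ℕ) (J : Finset (Finset (Fin n))) : Set (Finset (Fin n)) :=
  {X | X ∈ C n (k + 1) ∧ IsPrefix (packet k X ∩ J) (packet k X) ∧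
    packet k X ∩ J ≠ ∅ ∧ packet k X ∩ J ≠ packet k X}

/-- `J_s`: the `(k+1)`-sets whose packet meets `J` in a proper non-empty suffix. -/
def Js {n : ℕ} (k : ℕ) (J : Finset (Finset (Fin n))) : Set (Finset (Fin n)) :=
  {X | X ∈ C n (k + 1) ∧ IsSuffix (packet k X ∩ J) (packet k X) ∧
    packet k X ∩ J ≠ ∅ ∧ packet k X ∩ J ≠ packet k X}

/-- `J_F`: the `(k+1)`-sets whose packet is contained in `J`. -/
def JF {n : ℕ} (k : ℕ) (J : Finset (Finset (Fin n))) : Set (Finset (Fin n)) :=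
  {X | X ∈ C n (k + 1) ∧ packet k X ∩ J = packet k X}

/-- `A_J(n,k)`: the admissible `J`-orders. As `ρ` orders the members of `J` only, the order that
it induces on a packet `P_X` is an order on `P_X ∩ J`. -/
def AJ (n k : ℕ) (J : Finset (Finset (Fin n))) : Set (List (Finset (Fin n))) :=
  {ρ | IsTotalOrderOn ρ J ∧
    (∀ X ∈ Js k J, InducesAntilex ρ (packet k X)) ∧
    (∀ X ∈ Jp k J, InducesLex ρ (packet k X)) ∧
    (∀ X ∈ JF k J, InducesLex ρ (packet k X) ∨ InducesAntilex ρ (packet k X))}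

end HigherBruhat

/-! Write `k = j + 1`. The map `Inv` identifies `B(n,j)` with the realizable `k`-sets, and arrows
with the addition of one element; a path from the empty set to `J` is then an enumeration of `J` all
of whose initial segments are realizable.

Three facts give the identification. Inversion sets are exactly the realizable sets: necessity is a
three-element cycle argument (`consistent_of_pairwise_respects`), sufficiency an induction on the
largest ground element (`exists_pairwise_respects`). `Inv` is injective, because two orders under
the same constraints are sorted into each other by swaps of independent neighbours
(`reflTransGen_adjSwap`). If `U` and `insert X U` are both inversion sets, they are joined by an
arrow: the packet of `X` is an antichain in the intersection of two orders realizing them, so it can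
be made contiguous (`exists_block`).

It remains to see that an enumeration of `J` has realizable initial segments exactly if it is an
admissible `J`-order. An order running through each packet monotonically from the end at which `J`
starts cuts out segments (`realizable_take`). Conversely, a cut just after a wrongly placed element
determines the type of the segment there, and this contradicts the shape of `J` or another cut
(`mem_AJ_of_realizable_take`). -/

namespace HigherBruhat

/-! ### Every consistent collection is an inversion set -/

section Existence

variable {α : Type*} [LinearOrder α]

/-- Having `A` before `B` is compatible with ordering the packets of the members of `U`
antilexicographically and all other packets lexicographically. -/
def Respects (U : Set (Finset α)) (A B : Finset α) : Prop :=
  ∀ X, ∀ a ∈ X, ∀ b ∈ X, a < b →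
    (A = X.erase a → B = X.erase b → X ∈ U) ∧ (A = X.erase b → B = X.erase a → X ∉ U)

/-- The members of `U` in the packet of `Y` form an initial or a final segment. -/
def Consistent (U : Set (Finset α)) (Y : Finset α) : Prop :=
  (∀ a ∈ Y, ∀ b ∈ Y, a < b → Y.erase a ∈ U → Y.erase b ∈ U) ∨
    (∀ a ∈ Y, ∀ b ∈ Y, a < b → Y.erase b ∈ U → Y.erase a ∈ U)

theorem Consistent.contract {U : Set (Finset α)} {Y : Finset α} {m : α}
    (hm : ∀ x ∈ Y, x < m) (h : Consistent U (insert m Y)) :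
    Consistent {X | insert m X ∈ U} Y := by
  have e : ∀ a ∈ Y, insert m (Y.erase a) = (insert m Y).erase a := fun a ha =>
    (Finset.erase_insert_of_ne (hm a ha).ne').symm
  refine h.imp (fun h a ha b hb hab => ?_) (fun h a ha b hb hab => ?_) <;>
  · change insert m (Y.erase _) ∈ U → insert m (Y.erase _) ∈ U
    rw [e a ha, e b hb]
    exact h a (Finset.mem_insert_of_mem ha) b (Finset.mem_insert_of_mem hb) hab

theorem Respects.insert_of_contract {U : Set (Finset α)} {A B : Finset α} {m : α}
    (hA : m ∉ A) (hB : m ∉ B) (h : Respects {X | insert m X ∈ U} A B) :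
    Respects U (insert m A) (insert m B) := by
  intro X a ha b hb hab
  have key : ∀ {A : Finset α} {a : α}, m ∉ A → insert m A = X.erase a →
      m ∈ X ∧ a ≠ m ∧ A = (X.erase m).erase a := by
    intro A a hA e
    have hm : m ∈ X.erase a := e ▸ Finset.mem_insert_self m A
    refine ⟨Finset.mem_of_mem_erase hm, (Finset.ne_of_mem_erase hm).symm, ?_⟩
    rw [Finset.erase_right_comm, ← e, Finset.erase_insert hA]
  constructor
  · intro e₁ e₂
    obtain ⟨hm, ham, e₁⟩ := key hA e₁
    obtain ⟨-, hbm, e₂⟩ := key hB e₂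
    have := (h (X.erase m) a (Finset.mem_erase.2 ⟨ham, ha⟩) b
      (Finset.mem_erase.2 ⟨hbm, hb⟩) hab).1 e₁ e₂
    simpa [Finset.insert_erase hm] using this
  · intro e₁ e₂
    obtain ⟨hm, hbm, e₁⟩ := key hA e₁
    obtain ⟨-, ham, e₂⟩ := key hB e₂
    have := (h (X.erase m) a (Finset.mem_erase.2 ⟨ham, ha⟩) b
      (Finset.mem_erase.2 ⟨hbm, hb⟩) hab).2 e₁ e₂
    simpa [Finset.insert_erase hm] using this

theorem eq_insert_of_erase_eq {X A B : Finset α} {a b m : α} (hA : ∀ x ∈ A, x < m)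
    (ha : a ∈ X) (e₁ : A = X.erase a) (e₂ : insert m B = X.erase b) :
    a = m ∧ X = insert m A := by
  have hm : m ∈ X := Finset.mem_of_mem_erase (e₂ ▸ Finset.mem_insert_self m B)
  have ham : a = m := by
    by_contra hne
    exact lt_irrefl m (hA m (e₁ ▸ Finset.mem_erase.2 ⟨Ne.symm hne, hm⟩))
  subst ham
  exact ⟨rfl, by rw [e₁, Finset.insert_erase ha]⟩

/-- The only packet that can contain both sets is that of `insert m A`. There `A` arises by deleting
the maximum, so it is lexicographically first and must precede everything else if the packet is not
inverted. -/
theorem respects_insert_right {U : Set (Finset α)} {A B : Finset α} {m : α}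
    (hA : ∀ x ∈ A, x < m) (hU : insert m A ∉ U) : Respects U A (insert m B) := by
  intro X a ha b hb hab
  constructor
  · intro e₁ e₂
    obtain ⟨rfl, -⟩ := eq_insert_of_erase_eq hA ha e₁ e₂
    exact absurd (hA b (e₁ ▸ Finset.mem_erase.2 ⟨hab.ne', hb⟩)) hab.asymm
  · intro e₁ e₂
    obtain ⟨-, rfl⟩ := eq_insert_of_erase_eq hA hb e₁ e₂
    exact hU

theorem respects_insert_left {U : Set (Finset α)} {A B : Finset α} {m : α}
    (hA : ∀ x ∈ A, x < m) (hU : insert m A ∈ U) : Respects U (insert m B) A := by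
  intro X a ha b hb hab
  constructor
  · intro e₁ e₂
    obtain ⟨-, rfl⟩ := eq_insert_of_erase_eq hA hb e₂ e₁
    exact hU
  · intro e₁ e₂
    obtain ⟨rfl, -⟩ := eq_insert_of_erase_eq hA ha e₂ e₁
    exact absurd (hA b (e₂ ▸ Finset.mem_erase.2 ⟨hab.ne', hb⟩)) hab.asymm

/-- If `A` and `B` lie in the packet of `X`, the packet of `insert m X` contains `X` (its
lexicographic minimum), `insert m A` and `insert m B`. Since only the last of these two is in `U`,
the type of the segment cut out by `U` decides whether `X` is in `U`, in agreement with `A`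
preceding `B`. -/
theorem respects_of_consistent {U : Set (Finset α)} {A B : Finset α} {m : α}
    (hA : ∀ x ∈ A, x < m) (hB : ∀ x ∈ B, x < m)
    (hc : ∀ X a b, a ≠ b → A = X.erase a → B = X.erase b → a ∈ X → Consistent U (insert m X))
    (hAU : insert m A ∉ U) (hBU : insert m B ∈ U) : Respects U A B := by
  have lt : ∀ {X : Finset α} {a b : α}, a ≠ b → A = X.erase a → B = X.erase b →
      ∀ x ∈ X, x < m := by
    intro X a b hab e₁ e₂ x hx
    by_cases hxa : x = a
    · exact hB x (e₂ ▸ Finset.mem_erase.2 ⟨hxa ▸ hab, hx⟩)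
    · exact hA x (e₁ ▸ Finset.mem_erase.2 ⟨hxa, hx⟩)
  have er : ∀ {X : Finset α} {a : α}, (∀ x ∈ X, x < m) → a ∈ X →
      (insert m X).erase a = insert m (X.erase a) := fun hX ha =>
    Finset.erase_insert_of_ne (hX _ ha).ne'
  have em : ∀ {X : Finset α}, (∀ x ∈ X, x < m) → (insert m X).erase m = X := fun hX =>
    Finset.erase_insert fun h => lt_irrefl _ (hX _ h)
  intro X a ha b hb hab
  have ha' := Finset.mem_insert_of_mem (b := m) ha
  have hb' := Finset.mem_insert_of_mem (b := m) hb
  have hm' := Finset.mem_insert_self m X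
  constructor
  · intro e₁ e₂
    have hX := lt hab.ne e₁ e₂
    rcases hc X a b hab.ne e₁ e₂ ha with h | h
    · have := h b hb' m hm' (hX b hb)
      rw [er hX hb, em hX, ← e₂] at this
      exact this hBU
    · have := h a ha' b hb' hab
      rw [er hX hb, er hX ha, ← e₁, ← e₂] at this
      exact absurd (this hBU) hAU
  · intro e₁ e₂ hXU
    have hX := lt hab.ne' e₁ e₂
    rcases hc X b a hab.ne' e₁ e₂ hb with h | h
    · have := h a ha' b hb' hab
      rw [er hX hb, er hX ha, ← e₁, ← e₂] at this
      exact hAU (this hBU)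
    · have := h b hb' m hm' (hX b hb)
      rw [er hX hb, em hX, ← e₁] at this
      exact hAU (this hXU)

/-- A consistent collection is the inversion set of some total order. -/
theorem exists_pairwise_respects (S : Finset α) : ∀ (j : ℕ) (U : Set (Finset α)),
    (∀ Y ⊆ S, Y.card = j + 2 → Consistent U Y) →
    ∃ ρ : List (Finset α), IsTotalOrderOn ρ (S.powersetCard j) ∧ ρ.Pairwise (Respects U) := by
  classical
  induction S using Finset.induction_on_max with
  | empty =>
    rintro (_ | j) U -
    · exact ⟨[∅], by simp [IsTotalOrderOn], List.pairwise_singleton _ _⟩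
    · exact ⟨[], by simp [IsTotalOrderOn], List.Pairwise.nil⟩
  | insert m S hm ih =>
    have hmS : m ∉ S := fun h => lt_irrefl _ (hm m h)
    rintro (_ | j) U hU
    · exact ⟨[∅], by simp [IsTotalOrderOn], List.pairwise_singleton _ _⟩
    obtain ⟨ρ₁, ⟨nd₁, mem₁⟩, pw₁⟩ := ih (j + 1) U fun Y hY hc =>
      hU Y (hY.trans (Finset.subset_insert _ _)) hc
    obtain ⟨ρ₂, ⟨nd₂, mem₂⟩, pw₂⟩ := ih j {X | insert m X ∈ U} fun Y hY hc =>
      (hU (insert m Y) (Finset.insert_subset_insert _ hY) (by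
        rw [Finset.card_insert_of_notMem fun h => hmS (hY h), hc])).contract
        fun x hx => hm x (hY hx)
    simp only [Finset.mem_powersetCard] at mem₁ mem₂
    have lt₁ : ∀ A ∈ ρ₁, ∀ x ∈ A, x < m := fun A hA x hx => hm x (((mem₁ A).1 hA).1 hx)
    have nm₁ : ∀ A ∈ ρ₁, m ∉ A := fun A hA h => hmS (((mem₁ A).1 hA).1 h)
    have nm₂ : ∀ A ∈ ρ₂, m ∉ A := fun A hA h => hmS (((mem₂ A).1 hA).1 h)
    -- `ρ₁` orders the sets avoiding `m`, `ρ₂` those containing it (with `m` removed). In the packet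
    -- of `insert m A` the set `A` has to come first or last, according to whether `insert m A` is
    -- outside or inside `U`; hence `ρ₁` is split around the sets containing `m`.
    refine ⟨ρ₁.filter (fun A => insert m A ∉ U) ++ (ρ₂.map (insert m) ++
      ρ₁.filter (fun A => insert m A ∈ U)), ⟨?_, ?_⟩, ?_⟩
    · refine List.Nodup.append (nd₁.filter _) (List.Nodup.append ?_ (nd₁.filter _) ?_) ?_
      · refine (List.nodup_map_iff_inj_on nd₂).2 fun A hA B hB h => ?_
        rw [← Finset.erase_insert (nm₂ A hA), h, Finset.erase_insert (nm₂ B hB)]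
      · intro A hA hA'
        obtain ⟨B, -, rfl⟩ := List.mem_map.1 hA
        exact nm₁ _ (List.mem_filter.1 hA').1 (Finset.mem_insert_self _ _)
      · intro A hA hA'
        simp only [List.mem_filter, decide_eq_true_eq, List.mem_append] at hA hA'
        rcases hA' with h | h
        · obtain ⟨B, -, rfl⟩ := List.mem_map.1 h
          exact nm₁ _ hA.1 (Finset.mem_insert_self _ _)
        · exact hA.2 h.2
    · intro A
      simp only [List.mem_append, List.mem_filter, decide_eq_true_eq, List.mem_map, mem₁, mem₂,
        Finset.powersetCard_succ_insert hmS, Finset.mem_union, Finset.mem_image,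
        Finset.mem_powersetCard, Nat.succ_eq_add_one]
      by_cases hAU : insert m A ∈ U <;> simp [hAU, or_comm]
    · refine List.pairwise_append.2 ⟨pw₁.filter _, List.pairwise_append.2
        ⟨List.pairwise_map.2 (pw₂.imp_of_mem fun hA hB h => h.insert_of_contract (nm₂ _ hA) (nm₂ _ hB)),
          pw₁.filter _, ?_⟩, ?_⟩
      · intro A hA B hB
        obtain ⟨A, -, rfl⟩ := List.mem_map.1 hA
        simp only [List.mem_filter, decide_eq_true_eq] at hB
        exact respects_insert_left (lt₁ _ hB.1) hB.2
      · intro A hA B hB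
        simp only [List.mem_filter, decide_eq_true_eq, List.mem_append] at hA hB
        rcases hB with h | h
        · obtain ⟨B, -, rfl⟩ := List.mem_map.1 h
          exact respects_insert_right (lt₁ _ hA.1) hA.2
        · refine respects_of_consistent (lt₁ _ hA.1) (lt₁ _ h.1) ?_ hA.2 h.2
          intro X a b hab e₁ e₂ ha
          have hXS : X ⊆ S := by
            intro x hx
            by_cases hxa : x = a
            · exact ((mem₁ B).1 h.1).1 (e₂ ▸ Finset.mem_erase.2 ⟨hxa ▸ hab, hx⟩)
            · exact ((mem₁ A).1 hA.1).1 (e₁ ▸ Finset.mem_erase.2 ⟨hxa, hx⟩)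
          refine hU _ (Finset.insert_subset_insert _ hXS) ?_
          have := ((mem₁ A).1 hA.1).2
          rw [e₁, Finset.card_erase_of_mem ha] at this
          rw [Finset.card_insert_of_notMem fun h => hmS (hXS h)]
          omega

end Existence

/-! ### Linear orders as lists and swaps of independent neighbours -/

section Lists

variable {α : Type*}

/-- `A` comes before `B` in the list `ρ`. -/
abbrev Before [DecidableEq α] (ρ : List α) (A B : α) : Prop := ρ.idxOf A < ρ.idxOf B

theorem before_or_before [DecidableEq α] {ρ : List α} {A B : α} (hA : A ∈ ρ) (h : A ≠ B) :
    Before ρ A B ∨ Before ρ B A :=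
  lt_or_gt_of_ne fun e => h ((List.idxOf_inj hA).1 e)

theorem pairwise_iff_before [DecidableEq α] {ρ : List α} (hρ : ρ.Nodup) {R : α → α → Prop} :
    ρ.Pairwise R ↔ ∀ A ∈ ρ, ∀ B ∈ ρ, Before ρ A B → R A B := by
  rw [List.pairwise_iff_getElem]
  constructor
  · intro h A hA B hB hAB
    have := h _ _ (List.idxOf_lt_length_iff.2 hA) (List.idxOf_lt_length_iff.2 hB) hAB
    simpa using this
  · intro h i j hi hj hij
    refine h _ (List.getElem_mem hi) _ (List.getElem_mem hj) ?_
    simpa [Before, hρ.idxOf_getElem] using hij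

/-- The list `l'` arises from `l` by interchanging two neighbours that are not `dep`endent. -/
def AdjSwap (dep : α → α → Prop) (l l' : List α) : Prop :=
  ∃ (l₁ l₂ : List α) (U V : α),
    l = l₁ ++ U :: V :: l₂ ∧ l' = l₁ ++ V :: U :: l₂ ∧ ¬ dep U V

theorem AdjSwap.cons {dep : α → α → Prop} {l l' : List α} (a : α) (h : AdjSwap dep l l') :
    AdjSwap dep (a :: l) (a :: l') := by
  obtain ⟨l₁, l₂, U, V, rfl, rfl, h⟩ := h
  exact ⟨a :: l₁, l₂, U, V, rfl, rfl, h⟩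

theorem reflTransGen_adjSwap_move {dep : α → α → Prop} {a : α} (s : List α) :
    ∀ p : List α, (∀ x ∈ p, ¬ dep x a) →
      Relation.ReflTransGen (AdjSwap dep) (p ++ a :: s) (a :: (p ++ s))
  | [], _ => .refl
  | x :: p, h => by
    have h₁ := (reflTransGen_adjSwap_move s p fun y hy => h y (by simp [hy])).lift
      (x :: ·) fun _ _ => AdjSwap.cons x
    exact h₁.tail ⟨[], p ++ s, x, a, rfl, rfl, h x (by simp)⟩

/-- Two enumerations of a finite set compatible with the same constraints on dependent pairs are
connected by interchanges of independent neighbours. -/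
theorem reflTransGen_adjSwap {dep R : α → α → Prop}
    (hR : ∀ A B, R A B → R B A → A ≠ B → ¬ dep A B) :
    ∀ (l' l : List α), l.Perm l' → l'.Nodup → l.Pairwise R → l'.Pairwise R →
      Relation.ReflTransGen (AdjSwap dep) l l'
  | [], l, hp, _, _, _ => by rw [hp.eq_nil]
  | a :: t, l, hp, nd, hl, hl' => by
    obtain ⟨p, s, rfl⟩ := List.append_of_mem (hp.mem_iff.2 List.mem_cons_self)
    have hp' : (p ++ s).Perm t := (List.perm_middle.symm.trans hp).cons_inv
    rw [List.nodup_cons] at nd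
    rw [List.pairwise_cons] at hl'
    have hmem : ∀ x ∈ p, x ∈ t := fun x hx => hp'.mem_iff.1 (List.mem_append_left _ hx)
    -- Each `x` in `p` precedes `a` in `l` and follows it in `l'`, so `R` holds both ways and `a`
    -- may be moved to the front.
    have hpa : ∀ x ∈ p, ¬ dep x a := fun x hx => hR x a
      ((List.pairwise_append.1 hl).2.2 x hx a List.mem_cons_self) (hl'.1 x (hmem x hx))
      fun e => nd.1 (e ▸ hmem x hx)
    have hps : (p ++ s).Pairwise R :=
      hl.sublist ((List.sublist_cons_self a s).append_left p)
    exact (reflTransGen_adjSwap_move s p hpa).trans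
      ((reflTransGen_adjSwap hR t (p ++ s) hp' nd.2 hps hl'.2).lift (a :: ·)
        fun _ _ => AdjSwap.cons a)

end Lists

/-! ### Packets, lexicographic order and the constraints of an inversion set -/

section Packets

variable {n j : ℕ}

theorem mem_C {X : Finset (Fin n)} : X ∈ C n j ↔ X.card = j := by
  simp [C, Finset.mem_powersetCard]

theorem mem_packet {X A : Finset (Fin n)} (hX : X ∈ C n (j + 1)) :
    A ∈ packet j X ↔ ∃ a ∈ X, A = X.erase a := by
  rw [mem_C] at hX
  rw [packet, Finset.mem_powersetCard]
  constructor
  · rintro ⟨hA, hc⟩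
    have : (X \ A).card = 1 := by rw [Finset.card_sdiff_of_subset hA]; omega
    obtain ⟨a, ha⟩ := Finset.card_eq_one.1 this
    refine ⟨a, (Finset.mem_sdiff.1 (ha ▸ Finset.mem_singleton_self a)).1, ?_⟩
    rw [Finset.erase_eq, ← ha, Finset.sdiff_sdiff_eq_self hA]
  · rintro ⟨a, ha, rfl⟩
    exact ⟨Finset.erase_subset _ _, by rw [Finset.card_erase_of_mem ha]; omega⟩

theorem erase_mem_packet {X : Finset (Fin n)} (hX : X ∈ C n (j + 1)) {a : Fin n} (ha : a ∈ X) :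
    X.erase a ∈ packet j X :=
  (mem_packet hX).2 ⟨a, ha, rfl⟩

theorem packet_subset_C (X : Finset (Fin n)) : packet j X ⊆ C n j :=
  Finset.powersetCard_mono (Finset.subset_univ X)

theorem lexLT_erase_iff {X : Finset (Fin n)} {a b : Fin n} (ha : a ∈ X) (hb : b ∈ X) :
    LexLT (X.erase a) (X.erase b) ↔ b < a := by
  constructor
  · rintro ⟨c, hc, hc', h⟩
    have hcb : c = b := by
      by_contra hne
      exact hc' (Finset.mem_erase.2 ⟨hne, Finset.mem_of_mem_erase hc⟩)
    subst hcb
    rcases lt_trichotomy c a with h' | rfl | h'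
    · exact h'
    · exact absurd hc (Finset.notMem_erase _ _)
    · have := (h a h').2 (Finset.mem_erase.2 ⟨h'.ne, ha⟩)
      exact absurd this (Finset.notMem_erase _ _)
  · intro h
    refine ⟨b, Finset.mem_erase.2 ⟨h.ne, hb⟩, Finset.notMem_erase _ _, fun c hc => ?_⟩
    simp [Finset.mem_erase, hc.ne, (hc.trans h).ne]

theorem lexLT_or_eq_or_lexLT {X A B : Finset (Fin n)} (hX : X ∈ C n (j + 1))
    (hA : A ∈ packet j X) (hB : B ∈ packet j X) : LexLT A B ∨ A = B ∨ LexLT B A := by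
  obtain ⟨a, ha, rfl⟩ := (mem_packet hX).1 hA
  obtain ⟨b, hb, rfl⟩ := (mem_packet hX).1 hB
  rw [lexLT_erase_iff ha hb, lexLT_erase_iff hb ha]
  rcases lt_trichotomy a b with h | rfl | h <;> simp [*]

theorem not_lexLT_of_lexLT {X A B : Finset (Fin n)} (hX : X ∈ C n (j + 1))
    (hA : A ∈ packet j X) (hB : B ∈ packet j X) (h : LexLT A B) : ¬ LexLT B A := by
  obtain ⟨a, ha, rfl⟩ := (mem_packet hX).1 hA
  obtain ⟨b, hb, rfl⟩ := (mem_packet hX).1 hB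
  rw [lexLT_erase_iff ha hb] at h
  rw [lexLT_erase_iff hb ha]
  exact h.asymm

theorem eq_of_mem_packet {X Y A B : Finset (Fin n)} (hX : X ∈ C n (j + 1))
    (hY : Y ∈ C n (j + 1)) (hAB : A ≠ B) (hAX : A ∈ packet j X) (hBX : B ∈ packet j X)
    (hAY : A ∈ packet j Y) (hBY : B ∈ packet j Y) : X = Y := by
  have key : ∀ {Z : Finset (Fin n)}, Z ∈ C n (j + 1) → A ∈ packet j Z → B ∈ packet j Z →
      A ∪ B = Z := by
    intro Z hZ hA hB
    obtain ⟨a, ha, rfl⟩ := (mem_packet hZ).1 hA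
    obtain ⟨b, hb, rfl⟩ := (mem_packet hZ).1 hB
    have hab : a ≠ b := fun h => hAB (h ▸ rfl)
    ext x
    simp only [Finset.mem_union, Finset.mem_erase]
    constructor
    · rintro (h | h) <;> exact h.2
    · intro hx
      by_cases h : x = a
      · exact Or.inr ⟨h ▸ hab, hx⟩
      · exact Or.inl ⟨h, hx⟩
  rw [← key hX hAX hBX, key hY hAY hBY]

theorem inducesLex_iff {ρ : List (Finset (Fin n))} (hρ : ρ.Nodup)
    {P : Finset (Finset (Fin n))} :
    InducesLex ρ P ↔ ∀ A ∈ ρ, ∀ B ∈ ρ, A ∈ P → B ∈ P → Before ρ A B → LexLT A B := by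
  rw [InducesLex, List.pairwise_filter, pairwise_iff_before hρ]
  simp only [decide_eq_true_eq]
  exact ⟨fun h A hA B hB hAP hBP hAB => h A hA B hB hAB hAP hBP,
    fun h A hA B hB hAB hAP hBP => h A hA B hB hAP hBP hAB⟩

theorem inducesAntilex_iff {ρ : List (Finset (Fin n))} (hρ : ρ.Nodup)
    {P : Finset (Finset (Fin n))} :
    InducesAntilex ρ P ↔ ∀ A ∈ ρ, ∀ B ∈ ρ, A ∈ P → B ∈ P → Before ρ A B → LexLT B A := by
  rw [InducesAntilex, List.pairwise_filter, pairwise_iff_before hρ]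
  simp only [decide_eq_true_eq]
  exact ⟨fun h A hA B hB hAP hBP hAB => h A hA B hB hAB hAP hBP,
    fun h A hA B hB hAB hAP hBP => h A hA B hB hAP hBP hAB⟩

/-- An order is lexicographic on the packets outside `U` and antilexicographic on those in `U`
exactly if it respects `U`. -/
theorem pairwise_respects_iff {ρ : List (Finset (Fin n))} (hρ : IsTotalOrderOn ρ (C n j))
    {U : Set (Finset (Fin n))} :
    ρ.Pairwise (Respects U) ↔ ∀ X ∈ C n (j + 1), (X ∉ U → InducesLex ρ (packet j X)) ∧
      (X ∈ U → InducesAntilex ρ (packet j X)) := by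
  simp only [inducesLex_iff hρ.1, inducesAntilex_iff hρ.1, pairwise_iff_before hρ.1]
  constructor
  · intro h X hX
    constructor <;>
    · intro hXU A hA B hB hAX hBX hAB
      have := h A hA B hB hAB
      obtain ⟨a, ha, rfl⟩ := (mem_packet hX).1 hAX
      obtain ⟨b, hb, rfl⟩ := (mem_packet hX).1 hBX
      simp only [lexLT_erase_iff, ha, hb]
      rcases lt_trichotomy a b with h | rfl | h
      · have := (this X a ha b hb h).1 rfl rfl
        first | exact absurd this hXU | exact h
      · exact absurd hAB (lt_irrefl _)
      · have := (this X b hb a ha h).2 rfl rfl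
        first | exact absurd hXU this | exact h
  · intro h A hA B hB hAB X a ha b hb hab
    have key : ∀ c ∈ X, X.erase c ∈ ρ → X ∈ C n (j + 1) := fun c hc hcρ => by
      have := mem_C.1 ((hρ.2 _).1 hcρ)
      rw [Finset.card_erase_of_mem hc] at this
      have := Finset.card_pos.2 ⟨c, hc⟩
      exact mem_C.2 (by omega)
    constructor
    · rintro rfl rfl
      have hX := key a ha hA
      by_contra hXU
      have := (h X hX).1 hXU _ hA _ hB (erase_mem_packet hX ha) (erase_mem_packet hX hb) hAB
      exact hab.asymm ((lexLT_erase_iff ha hb).1 this)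
    · rintro rfl rfl hXU
      have hX := key b hb hA
      have := (h X hX).2 hXU _ hA _ hB (erase_mem_packet hX hb) (erase_mem_packet hX ha) hAB
      exact hab.asymm ((lexLT_erase_iff ha hb).1 this)

/-- This is where `k > 1` enters: for `1 ≤ j` a packet has at least two members, so the two orders
exclude each other and the inversion set determines the constraints. -/
theorem not_inducesLex_of_inducesAntilex (hj : 1 ≤ j) {ρ : List (Finset (Fin n))}
    (hρ : IsTotalOrderOn ρ (C n j)) {X : Finset (Fin n)} (hX : X ∈ C n (j + 1))
    (h : InducesAntilex ρ (packet j X)) : ¬ InducesLex ρ (packet j X) := by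
  intro h'
  rw [inducesLex_iff hρ.1] at h'
  rw [inducesAntilex_iff hρ.1] at h
  obtain ⟨a, ha, b, hb, hab⟩ := Finset.one_lt_card.1 (show 1 < X.card by rw [mem_C.1 hX]; omega)
  have hA := erase_mem_packet hX ha
  have hB := erase_mem_packet hX hb
  have hAρ := (hρ.2 _).2 (packet_subset_C X hA)
  have hBρ := (hρ.2 _).2 (packet_subset_C X hB)
  have hne : X.erase a ≠ X.erase b := fun e =>
    Finset.notMem_erase a X (e ▸ Finset.mem_erase.2 ⟨hab, ha⟩)
  rcases before_or_before hAρ hne with hb | hb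
  · exact not_lexLT_of_lexLT hX hA hB (h' _ hAρ _ hBρ hA hB hb) (h _ hAρ _ hBρ hA hB hb)
  · exact not_lexLT_of_lexLT hX hB hA (h' _ hBρ _ hAρ hB hA hb) (h _ hBρ _ hAρ hB hA hb)

theorem mem_invOrder {ρ : List (Finset (Fin n))} {X : Finset (Fin n)} :
    X ∈ invOrder j ρ ↔ X ∈ C n (j + 1) ∧ InducesAntilex ρ (packet j X) := by
  simp [invOrder]

theorem pairwise_respects_invOrder {ρ : List (Finset (Fin n))} (hρ : ρ ∈ A n j) :
    ρ.Pairwise (Respects (invOrder j ρ : Set (Finset (Fin n)))) := by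
  rw [pairwise_respects_iff hρ.1]
  intro X hX
  refine ⟨fun h => (hρ.2 X hX).resolve_right fun h' => h (mem_invOrder.2 ⟨hX, h'⟩), fun h => ?_⟩
  exact (mem_invOrder.1 h).2

theorem mem_A_of_pairwise_respects {ρ : List (Finset (Fin n))} (hρ : IsTotalOrderOn ρ (C n j))
    {U : Set (Finset (Fin n))} (h : ρ.Pairwise (Respects U)) : ρ ∈ A n j := by
  rw [pairwise_respects_iff hρ] at h
  refine ⟨hρ, fun X hX => ?_⟩
  by_cases hXU : X ∈ U
  · exact Or.inr ((h X hX).2 hXU)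
  · exact Or.inl ((h X hX).1 hXU)

theorem invOrder_eq_of_pairwise_respects (hj : 1 ≤ j) {ρ : List (Finset (Fin n))}
    (hρ : IsTotalOrderOn ρ (C n j)) {U : Finset (Finset (Fin n))} (hU : U ⊆ C n (j + 1))
    (h : ρ.Pairwise (Respects (U : Set (Finset (Fin n))))) : invOrder j ρ = U := by
  rw [pairwise_respects_iff hρ] at h
  ext X
  rw [mem_invOrder]
  refine ⟨fun ⟨hX, hX'⟩ => ?_, fun hXU => ⟨hU hXU, (h X (hU hXU)).2 hXU⟩⟩
  by_contra hXU
  exact not_inducesLex_of_inducesAntilex hj hρ hX hX' ((h X hX).1 hXU)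

end Packets

/-! ### Elements of `B(n,j)` and realizable sets -/

section InversionSets

variable {n j : ℕ}

theorem isPrefix_packet_iff {U : Finset (Finset (Fin n))} {X : Finset (Fin n)}
    (hX : X ∈ C n (j + 1)) :
    IsPrefix (packet j X ∩ U) (packet j X) ↔
      ∀ a ∈ X, ∀ b ∈ X, a < b → X.erase a ∈ U → X.erase b ∈ U := by
  constructor
  · intro h a ha b hb hab haU
    exact (Finset.mem_inter.1 (h.2 _ (erase_mem_packet hX hb) _
      (Finset.mem_inter.2 ⟨erase_mem_packet hX ha, haU⟩) ((lexLT_erase_iff hb ha).2 hab))).2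
  · refine fun h => ⟨Finset.inter_subset_left, fun A hA B hB hAB => ?_⟩
    rw [Finset.mem_inter] at hB ⊢
    refine ⟨hA, ?_⟩
    obtain ⟨a, ha, rfl⟩ := (mem_packet hX).1 hA
    obtain ⟨b, hb, rfl⟩ := (mem_packet hX).1 hB.1
    exact h b hb a ha ((lexLT_erase_iff ha hb).1 hAB) hB.2

theorem isSuffix_packet_iff {U : Finset (Finset (Fin n))} {X : Finset (Fin n)}
    (hX : X ∈ C n (j + 1)) :
    IsSuffix (packet j X ∩ U) (packet j X) ↔
      ∀ a ∈ X, ∀ b ∈ X, a < b → X.erase b ∈ U → X.erase a ∈ U := by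
  constructor
  · intro h a ha b hb hab hbU
    exact (Finset.mem_inter.1 (h.2 _ (erase_mem_packet hX ha) _
      (Finset.mem_inter.2 ⟨erase_mem_packet hX hb, hbU⟩) ((lexLT_erase_iff hb ha).2 hab))).2
  · refine fun h => ⟨Finset.inter_subset_left, fun A hA B hB hAB => ?_⟩
    rw [Finset.mem_inter] at hB ⊢
    refine ⟨hA, ?_⟩
    obtain ⟨a, ha, rfl⟩ := (mem_packet hX).1 hA
    obtain ⟨b, hb, rfl⟩ := (mem_packet hX).1 hB.1
    exact h a ha b hb ((lexLT_erase_iff hb ha).1 hAB) hB.2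

theorem realizable_iff {U : Finset (Finset (Fin n))} :
    Realizable j U ↔ U ⊆ C n j ∧
      ∀ X ∈ C n (j + 1), Consistent (U : Set (Finset (Fin n))) X := by
  refine and_congr_right fun _ => forall₂_congr fun X hX => ?_
  rw [isPrefix_packet_iff hX, isSuffix_packet_iff hX]
  rfl

theorem Realizable.exists_pairwise_respects {U : Finset (Finset (Fin n))}
    (hU : Realizable (j + 1) U) :
    ∃ ρ, IsTotalOrderOn ρ (C n j) ∧ ρ.Pairwise (Respects (U : Set (Finset (Fin n)))) :=
  HigherBruhat.exists_pairwise_respects Finset.univ j (U : Set (Finset (Fin n))) fun Y _ hY =>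
    (realizable_iff.1 hU).2 Y (mem_C.2 hY)

theorem before_erase_erase {ρ : List (Finset (Fin n))} (hρ : IsTotalOrderOn ρ (C n j))
    {U : Set (Finset (Fin n))} (h : ρ.Pairwise (Respects U)) {X : Finset (Fin n)}
    (hX : X ∈ C n (j + 1)) {a b : Fin n} (ha : a ∈ X) (hb : b ∈ X) (hab : a < b) :
    (X ∉ U → Before ρ (X.erase b) (X.erase a)) ∧
      (X ∈ U → Before ρ (X.erase a) (X.erase b)) := by
  rw [pairwise_iff_before hρ.1] at h
  have hA := (hρ.2 _).2 (packet_subset_C X (erase_mem_packet hX ha))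
  have hB := (hρ.2 _).2 (packet_subset_C X (erase_mem_packet hX hb))
  have hne : X.erase a ≠ X.erase b := fun e =>
    Finset.notMem_erase a X (e ▸ Finset.mem_erase.2 ⟨hab.ne, ha⟩)
  constructor <;> intro hXU <;> rcases before_or_before hA hne with hb' | hb'
  · exact absurd ((h _ hA _ hB hb' X a ha b hb hab).1 rfl rfl) hXU
  · exact hb'
  · exact hb'
  · exact absurd hXU ((h _ hB _ hA hb' X a ha b hb hab).2 rfl rfl)

theorem consistent_of_pairwise_respects {ρ : List (Finset (Fin n))}
    (hρ : IsTotalOrderOn ρ (C n j)) {U : Set (Finset (Fin n))} (h : ρ.Pairwise (Respects U))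
    {Y : Finset (Fin n)} (hY : Y ∈ C n (j + 2)) : Consistent U Y := by
  -- The three sets obtained from `Y` by deleting two of `x`, `y`, `z` lie pairwise in the packets
  -- of `Y.erase x`, `Y.erase y`, `Y.erase z`. An alternating membership pattern of these in `U`
  -- would order them cyclically.
  have key : ∀ x ∈ Y, ∀ y ∈ Y, ∀ z ∈ Y, x < y → y < z →
      ¬ (Y.erase x ∈ U ∧ Y.erase y ∉ U ∧ Y.erase z ∈ U) ∧
      ¬ (Y.erase x ∉ U ∧ Y.erase y ∈ U ∧ Y.erase z ∉ U) := by
    intro x hx y hy z hz hxy hyz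
    have hC : ∀ {w}, w ∈ Y → Y.erase w ∈ C n (j + 1) := fun hw => mem_C.2 (by
      rw [Finset.card_erase_of_mem hw, mem_C.1 hY]; rfl)
    have hxz := hxy.trans hyz
    have h₁ := before_erase_erase hρ h (hC hx) (Finset.mem_erase.2 ⟨hxy.ne', hy⟩)
      (Finset.mem_erase.2 ⟨hxz.ne', hz⟩) hyz
    have h₂ := before_erase_erase hρ h (hC hy) (Finset.mem_erase.2 ⟨hxy.ne, hx⟩)
      (Finset.mem_erase.2 ⟨hyz.ne', hz⟩) hxz
    have h₃ := before_erase_erase hρ h (hC hz) (Finset.mem_erase.2 ⟨hxz.ne, hx⟩)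
      (Finset.mem_erase.2 ⟨hyz.ne, hy⟩) hxy
    rw [Finset.erase_right_comm (a := y) (b := x)] at h₂
    rw [Finset.erase_right_comm (a := z) (b := x), Finset.erase_right_comm (a := z) (b := y)]
      at h₃
    constructor
    · rintro ⟨hx, hy, hz⟩
      exact lt_irrefl _ (((h₁.2 hx).trans (h₃.2 hz)).trans (h₂.1 hy))
    · rintro ⟨hx, hy, hz⟩
      exact lt_irrefl _ (((h₂.2 hy).trans (h₃.1 hz)).trans (h₁.1 hx))
  by_contra hc
  simp only [Consistent, not_or] at hc
  push Not at hc
  obtain ⟨⟨a, ha, b, hb, hab, haU, hbU⟩, c, hc, d, hd, hcd, hdU, hcU⟩ := hc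
  -- `a < b` refutes an initial segment and `c < d` a final one; whichever of `b` and `d` is larger
  -- completes the other pair to an alternating triple.
  rcases lt_trichotomy b d with hbd | rfl | hbd
  · exact (key a ha b hb d hd hab hbd).1 ⟨haU, hbU, hdU⟩
  · exact hbU hdU
  · exact (key c hc d hd b hb hcd hbd).2 ⟨hcU, hdU, hbU⟩

theorem realizable_invOrder {ρ : List (Finset (Fin n))} (hρ : ρ ∈ A n j) :
    Realizable (j + 1) (invOrder j ρ) :=
  realizable_iff.2 ⟨fun _ h => (mem_invOrder.1 h).1, fun _ hY =>
    consistent_of_pairwise_respects hρ.1 (pairwise_respects_invOrder hρ) hY⟩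

theorem realizable_Inv (r : B n j) : Realizable (j + 1) (Inv r) := by
  induction r using Quot.ind with
  | mk ρ => exact realizable_invOrder ρ.2

theorem filter_eq_of_adjSwap {ρ ρ' : List (Finset (Fin n))}
    (h : AdjSwap (fun U V => ∃ X ∈ C n (j + 1), U ∈ packet j X ∧ V ∈ packet j X) ρ ρ')
    {X : Finset (Fin n)} (hX : X ∈ C n (j + 1)) :
    ρ'.filter (· ∈ packet j X) = ρ.filter (· ∈ packet j X) := by
  obtain ⟨l₁, l₂, U, V, rfl, rfl, hUV⟩ := h
  by_cases hU : U ∈ packet j X <;> by_cases hV : V ∈ packet j X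
  · exact absurd ⟨X, hX, hU, hV⟩ hUV
  all_goals simp [List.filter_append, hU, hV]

theorem mem_A_of_adjSwap {ρ ρ' : List (Finset (Fin n))} (hρ : ρ ∈ A n j)
    (h : AdjSwap (fun U V => ∃ X ∈ C n (j + 1), U ∈ packet j X ∧ V ∈ packet j X) ρ ρ') :
    ρ' ∈ A n j := by
  refine ⟨?_, fun X hX => ?_⟩
  · obtain ⟨l₁, l₂, U, V, rfl, rfl, -⟩ := h
    have hp : (l₁ ++ U :: V :: l₂).Perm (l₁ ++ V :: U :: l₂) :=
      (List.Perm.swap V U l₂).append_left l₁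
    exact ⟨hp.nodup_iff.1 hρ.1.1, fun W => hp.mem_iff.symm.trans (hρ.1.2 W)⟩
  · have := hρ.2 X hX
    simpa only [InducesLex, InducesAntilex, filter_eq_of_adjSwap h hX] using this

theorem mk_eq_mk_of_reflTransGen {ρ ρ' : List (Finset (Fin n))} (hρ : ρ ∈ A n j)
    (h : Relation.ReflTransGen
      (AdjSwap (fun U V => ∃ X ∈ C n (j + 1), U ∈ packet j X ∧ V ∈ packet j X)) ρ ρ') :
    ∃ hρ' : ρ' ∈ A n j, (Quot.mk _ ⟨ρ', hρ'⟩ : B n j) = Quot.mk _ ⟨ρ, hρ⟩ := by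
  induction h with
  | refl => exact ⟨hρ, rfl⟩
  | tail _ h ih =>
    obtain ⟨h₁, e⟩ := ih
    exact ⟨mem_A_of_adjSwap h₁ h, by rw [← e]; exact (Quot.sound (r := ElemEquiv) (a := ⟨_, h₁⟩) (b := ⟨_, _⟩) h).symm⟩

theorem not_mem_packet_of_respects {U : Set (Finset (Fin n))} {A B : Finset (Fin n)}
    (h₁ : Respects U A B) (h₂ : Respects U B A) (hne : A ≠ B) :
    ¬ ∃ X ∈ C n (j + 1), A ∈ packet j X ∧ B ∈ packet j X := by
  rintro ⟨X, hX, hA, hB⟩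
  obtain ⟨a, ha, rfl⟩ := (mem_packet hX).1 hA
  obtain ⟨b, hb, rfl⟩ := (mem_packet hX).1 hB
  rcases lt_trichotomy a b with h | rfl | h
  · exact (h₂ X a ha b hb h).2 rfl rfl ((h₁ X a ha b hb h).1 rfl rfl)
  · exact hne rfl
  · exact (h₁ X b hb a ha h).2 rfl rfl ((h₂ X b hb a ha h).1 rfl rfl)

/-- Two representatives with the same inversion set obey the same constraints; a pair that they
order differently lies in no common packet, so elementary equivalences connect them. -/
theorem Inv_injective : Function.Injective (Inv : B n j → _) := by
  intro r r' h
  induction r using Quot.ind with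
  | mk ρ =>
  induction r' using Quot.ind with
  | mk ρ' =>
  change invOrder j ρ.1 = invOrder j ρ'.1 at h
  have h₁ := pairwise_respects_invOrder ρ.2
  have h₂ := pairwise_respects_invOrder ρ'.2
  rw [← h] at h₂
  have hp : ρ.1.Perm ρ'.1 := (List.perm_ext_iff_of_nodup ρ.2.1.1 ρ'.2.1.1).2 fun W =>
    (ρ.2.1.2 W).trans (ρ'.2.1.2 W).symm
  obtain ⟨_, e⟩ := mk_eq_mk_of_reflTransGen ρ.2 (reflTransGen_adjSwap
    (fun _ _ => not_mem_packet_of_respects) ρ'.1 ρ.1 hp ρ'.2.1.1 h₁ h₂)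
  exact e.symm

theorem exists_Inv_eq (hj : 1 ≤ j) {U : Finset (Finset (Fin n))} (hU : Realizable (j + 1) U) :
    ∃ r : B n j, Inv r = U := by
  obtain ⟨ρ, hρ, h⟩ := hU.exists_pairwise_respects
  exact ⟨Quot.mk _ ⟨ρ, mem_A_of_pairwise_respects hρ h⟩,
    invOrder_eq_of_pairwise_respects hj hρ hU.1 h⟩

end InversionSets

/-! ### Arrows as additions of one element to the inversion set -/

section Flips

variable {n j : ℕ}

theorem PacketFlip.perm {X : Finset (Fin n)} {ρ ρ' : List (Finset (Fin n))}
    (h : PacketFlip j X ρ ρ') : ρ.Perm ρ' := by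
  obtain ⟨l₁, c, l₂, rfl, rfl, -⟩ := h
  exact ((List.reverse_perm c).symm.append_left l₁).append_right l₂

theorem PacketFlip.filter_self {X : Finset (Fin n)} {ρ ρ' : List (Finset (Fin n))}
    (h : PacketFlip j X ρ ρ') (hρ : ρ.Nodup) :
    ρ'.filter (· ∈ packet j X) = (ρ.filter (· ∈ packet j X)).reverse := by
  obtain ⟨l₁, c, l₂, rfl, rfl, hc⟩ := h
  rw [List.nodup_append, List.nodup_append] at hρ
  have h₁ : l₁.filter (· ∈ packet j X) = [] := List.filter_eq_nil_iff.2 fun A hA hAX =>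
    hρ.1.2.2 A hA A ((hc A).2 (by simpa using hAX)) rfl
  have h₂ : l₂.filter (· ∈ packet j X) = [] := List.filter_eq_nil_iff.2 fun A hA hAX =>
    hρ.2.2 A (List.mem_append_right _ ((hc A).2 (by simpa using hAX))) A hA rfl
  simp [List.filter_append, h₁, h₂]

/-- Two distinct packets share at most one member, so reversing the block does not affect the order
on any other packet. -/
theorem PacketFlip.filter_of_ne {X Y : Finset (Fin n)} {ρ ρ' : List (Finset (Fin n))}
    (h : PacketFlip j X ρ ρ') (hρ : ρ.Nodup) (hX : X ∈ C n (j + 1)) (hY : Y ∈ C n (j + 1))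
    (hXY : Y ≠ X) : ρ'.filter (· ∈ packet j Y) = ρ.filter (· ∈ packet j Y) := by
  obtain ⟨l₁, c, l₂, rfl, rfl, hc⟩ := h
  have hnd : (c.filter (· ∈ packet j Y)).Nodup :=
    ((List.nodup_append.1 (List.nodup_append.1 hρ).1).2.1).filter _
  have hr : (c.filter (· ∈ packet j Y)).reverse = c.filter (· ∈ packet j Y) := by
    match e : c.filter (· ∈ packet j Y) with
    | [] => rfl
    | [_] => rfl
    | a :: b :: l =>
      rw [e, List.nodup_cons] at hnd
      have ha : a ∈ c.filter (· ∈ packet j Y) := by rw [e]; simp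
      have hb : b ∈ c.filter (· ∈ packet j Y) := by rw [e]; simp
      simp only [List.mem_filter, decide_eq_true_eq] at ha hb
      exact absurd (eq_of_mem_packet hY hX (fun h => hnd.1 (by rw [h]; exact List.mem_cons_self)) ha.2 hb.2
        ((hc a).1 ha.1) ((hc b).1 hb.1)) hXY
  simp [List.filter_append, hr]

theorem PacketFlip.pairwise_respects {X : Finset (Fin n)} {ρ ρ' : List (Finset (Fin n))}
    (h : PacketFlip j X ρ ρ') (hρ : IsTotalOrderOn ρ (C n j)) (hX : X ∈ C n (j + 1))
    {U : Set (Finset (Fin n))} (hXU : X ∉ U) (hU : ρ.Pairwise (Respects U)) :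
    IsTotalOrderOn ρ' (C n j) ∧ ρ'.Pairwise (Respects (insert X U)) := by
  have hρ' : IsTotalOrderOn ρ' (C n j) :=
    ⟨h.perm.nodup_iff.1 hρ.1, fun W => h.perm.mem_iff.symm.trans (hρ.2 W)⟩
  refine ⟨hρ', ?_⟩
  rw [pairwise_respects_iff hρ] at hU
  rw [pairwise_respects_iff hρ']
  intro Y hY
  by_cases hXY : Y = X
  · subst hXY
    refine ⟨fun h => absurd (Set.mem_insert _ _) h, fun _ => ?_⟩
    rw [InducesAntilex, h.filter_self hρ.1, List.pairwise_reverse]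
    exact (hU Y hY).1 hXU
  · simpa [InducesLex, InducesAntilex, h.filter_of_ne hρ.1 hX hY hXY, hXY] using hU Y hY

theorem FlipUp.Inv_eq (hj : 1 ≤ j) {r r' : B n j} {X : Finset (Fin n)} (h : FlipUp r X r') :
    Inv r' = insert X (Inv r) := by
  obtain ⟨hX, hXr, ρ, ρ', rfl, rfl, hf⟩ := h
  obtain ⟨h₁, h₂⟩ := hf.pairwise_respects ρ.2.1 hX hXr (pairwise_respects_invOrder ρ.2)
  refine invOrder_eq_of_pairwise_respects hj h₁ (Finset.insert_subset hX
    (realizable_invOrder ρ.2).1) ?_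
  rw [Finset.coe_insert]
  exact h₂

/-- If `B` does not precede `A` both in an order with inversion set `U` and in one with inversion
set `U ∪ {X}`, then `A` may precede `B`. -/
theorem respects_of_before {ρ ρ' : List (Finset (Fin n))} {U : Set (Finset (Fin n))}
    {X : Finset (Fin n)} (hρ : ρ.Nodup) (hρ' : ρ'.Nodup) (h : ρ.Pairwise (Respects U))
    (h' : ρ'.Pairwise (Respects (insert X U))) {A B : Finset (Fin n)} (hX : X ∈ C n (j + 1))
    (hA : A ∈ ρ) (hB : B ∈ ρ) (hA' : A ∈ ρ') (hB' : B ∈ ρ')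
    (hAB : ¬ (A ∈ packet j X ∧ B ∈ packet j X))
    (hn : ¬ (Before ρ B A ∧ Before ρ' B A)) : Respects U A B := by
  rw [pairwise_iff_before hρ] at h
  rw [pairwise_iff_before hρ'] at h'
  by_cases hne : A = B
  · subst hne
    intro Y a ha b hb hab
    have key : ∀ {a b}, a ∈ Y → a < b ∨ b < a → A = Y.erase a → A = Y.erase b → False :=
      fun {a b} ha hab e₁ e₂ => Finset.notMem_erase a Y
        ((e₁.symm.trans e₂) ▸ Finset.mem_erase.2 ⟨by rcases hab with h | h; exacts [h.ne, h.ne'], ha⟩)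
    exact ⟨fun e₁ e₂ => (key ha (Or.inl hab) e₁ e₂).elim,
      fun e₁ e₂ => (key ha (Or.inl hab) e₂ e₁).elim⟩
  rcases before_or_before hA hne with h₁ | h₁
  · exact h A hA B hB h₁
  rcases before_or_before hA' hne with h₂ | h₂
  -- Here only `ρ'` has `A` before `B`. It obeys the constraints of `insert X U`, which agree with
  -- those of `U` on every packet other than that of `X`.
  · intro Y a ha b hb hab
    have hYX : (A = Y.erase a ∧ B = Y.erase b) ∨ (A = Y.erase b ∧ B = Y.erase a) → Y ≠ X := by
      rintro (⟨rfl, rfl⟩ | ⟨rfl, rfl⟩) rfl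
      · exact hAB ⟨erase_mem_packet hX ha, erase_mem_packet hX hb⟩
      · exact hAB ⟨erase_mem_packet hX hb, erase_mem_packet hX ha⟩
    have := h' A hA' B hB' h₂ Y a ha b hb hab
    refine ⟨fun e₁ e₂ => ?_, fun e₁ e₂ hU => this.2 e₁ e₂ (Set.mem_insert_of_mem X hU)⟩
    exact (this.1 e₁ e₂).resolve_left (hYX (Or.inl ⟨e₁, e₂⟩))
  · exact absurd ⟨h₁, h₂⟩ hn

/-- A class has a representative in which the packet of `X` is a contiguous block as soon as `X`
can be added to its inversion set. -/
theorem exists_block {U : Set (Finset (Fin n))} {X : Finset (Fin n)} (hX : X ∈ C n (j + 1))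
    (hXU : X ∉ U) {ρ ρ' : List (Finset (Fin n))} (hρ : IsTotalOrderOn ρ (C n j))
    (hρ' : IsTotalOrderOn ρ' (C n j)) (h : ρ.Pairwise (Respects U))
    (h' : ρ'.Pairwise (Respects (insert X U))) :
    ∃ l₁ c l₂ : List (Finset (Fin n)), (∀ V, V ∈ c ↔ V ∈ packet j X) ∧
      IsTotalOrderOn (l₁ ++ c ++ l₂) (C n j) ∧ (l₁ ++ c ++ l₂).Pairwise (Respects U) := by
  classical
  -- `D` collects the sets outside the packet that are forced in front of the block: those below
  -- some packet member in the intersection of the two orders.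
  let D : Finset (Fin n) → Prop := fun Z =>
    Z ∉ packet j X ∧ ∃ V ∈ packet j X, Before ρ Z V ∧ Before ρ' Z V
  have hP : ∀ V ∈ packet j X, V ∈ ρ := fun V hV => (hρ.2 V).2 (packet_subset_C X hV)
  have hρρ' : ∀ V ∈ ρ, V ∈ ρ' := fun V hV => (hρ'.2 V).2 ((hρ.2 V).1 hV)
  have resp : ∀ {A B}, A ∈ ρ → B ∈ ρ → ¬ (A ∈ packet j X ∧ B ∈ packet j X) →
      ¬ (Before ρ B A ∧ Before ρ' B A) → Respects U A B := fun {A B} hA hB =>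
    respects_of_before hρ.1 hρ'.1 h h' hX hA hB (hρρ' A hA) (hρρ' B hB)
  -- `ρ` is lexicographic and `ρ'` antilexicographic on the packet, so it is an antichain in the
  -- intersection of the two orders.
  have hconv : ∀ V ∈ packet j X, ∀ W ∈ packet j X, ¬ (Before ρ V W ∧ Before ρ' V W) := by
    rintro V hV W hW ⟨hb, hb'⟩
    have h₁ := (inducesLex_iff hρ.1).1 (((pairwise_respects_iff hρ).1 h X hX).1 hXU)
      V (hP V hV) W (hP W hW) hV hW hb
    have h₂ := (inducesAntilex_iff hρ'.1).1
      (((pairwise_respects_iff hρ').1 h' X hX).2 (Set.mem_insert X U))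
      V (hρρ' V (hP V hV)) W (hρρ' W (hP W hW)) hV hW hb'
    exact not_lexLT_of_lexLT hX hV hW h₁ h₂
  refine ⟨ρ.filter D, ρ.filter (· ∈ packet j X),
    ρ.filter (fun Z => ¬ D Z ∧ Z ∉ packet j X), ?_, ⟨?_, ?_⟩, ?_⟩
  · intro V
    simp only [List.mem_filter, decide_eq_true_eq, and_iff_right_iff_imp]
    exact hP V
  · refine List.Nodup.append (List.Nodup.append (hρ.1.filter _) (hρ.1.filter _) ?_)
      (hρ.1.filter _) ?_
    · intro V h₁ h₂
      simp only [List.mem_filter, decide_eq_true_eq] at h₁ h₂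
      exact h₁.2.1 h₂.2
    · intro V h₁ h₂
      simp only [List.mem_append, List.mem_filter, decide_eq_true_eq] at h₁ h₂
      rcases h₁ with h₁ | h₁
      exacts [h₂.2.1 h₁.2, h₂.2.2 h₁.2]
  · intro V
    rw [← hρ.2 V]
    simp only [List.mem_append, List.mem_filter, decide_eq_true_eq]
    by_cases hD : D V <;> by_cases hVX : V ∈ packet j X <;> simp [hD, hVX]
  · rw [List.pairwise_append, List.pairwise_append]
    simp only [List.mem_append, List.mem_filter, decide_eq_true_eq]
    refine ⟨⟨h.filter _, h.filter _, ?_⟩, h.filter _, ?_⟩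
    · rintro Z ⟨hZ, hZX, V, hV, hb, hb'⟩ W ⟨hW, hWX⟩
      exact resp hZ hW (fun h => hZX h.1) fun hn =>
        hconv W hWX V hV ⟨hn.1.trans hb, hn.2.trans hb'⟩
    · rintro V (⟨hV, hVX, W, hW, hb, hb'⟩ | ⟨hV, hVX⟩) Z ⟨hZ, hZD, hZX⟩
      · exact resp hV hZ (fun h => hVX h.1) fun hn =>
          hZD ⟨hZX, W, hW, hn.1.trans hb, hn.2.trans hb'⟩
      · exact resp hV hZ (fun h => hZX h.2) fun hn => hZD ⟨hZX, V, hVX, hn⟩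

theorem exists_flipUp (hj : 1 ≤ j) {r r' : B n j} {X : Finset (Fin n)} (hX : X ∉ Inv r)
    (h : Inv r' = insert X (Inv r)) : FlipUp r X r' := by
  have hXC : X ∈ C n (j + 1) := (realizable_Inv r').1 (h ▸ Finset.mem_insert_self _ _)
  obtain ⟨ρ, hρ, hU⟩ := (realizable_Inv r).exists_pairwise_respects
  obtain ⟨ρ', hρ', hU'⟩ := (realizable_Inv r').exists_pairwise_respects
  rw [h, Finset.coe_insert] at hU'
  obtain ⟨l₁, c, l₂, hc, hσ, hσU⟩ := exists_block hXC hX hρ hρ' hU hU'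
  have hf : PacketFlip j X (l₁ ++ c ++ l₂) (l₁ ++ c.reverse ++ l₂) :=
    ⟨l₁, c, l₂, rfl, rfl, hc⟩
  obtain ⟨hσ', hσU'⟩ := hf.pairwise_respects hσ hXC hX hσU
  refine ⟨hXC, hX, ⟨_, mem_A_of_pairwise_respects hσ hσU⟩,
    ⟨_, mem_A_of_pairwise_respects hσ' hσU'⟩, Inv_injective ?_, Inv_injective ?_, hf⟩
  · exact invOrder_eq_of_pairwise_respects hj hσ (realizable_Inv r).1 hσU
  · rw [← Finset.coe_insert, ← h] at hσU'
    exact invOrder_eq_of_pairwise_respects hj hσ' (realizable_Inv r').1 hσU'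

end Flips

/-! ### Admissible `J`-orders and realizable initial segments -/

section AdmissibleOrders

variable {n k : ℕ} {J : Finset (Finset (Fin n))} {ρ : List (Finset (Fin n))}

/-- This merges the cases of the definition: the direction of `ρ` always matches the end of the
packet at which `J` starts. A full packet is a segment of both kinds, so either direction is
allowed; an empty intersection makes the order condition vacuous. -/
theorem isPrefix_and_inducesLex_or (hJ : Realizable k J) (hρ : ρ ∈ AJ n k J)
    {X : Finset (Fin n)} (hX : X ∈ C n (k + 1)) :
    (IsPrefix (packet k X ∩ J) (packet k X) ∧ InducesLex ρ (packet k X)) ∨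
      (IsSuffix (packet k X ∩ J) (packet k X) ∧ InducesAntilex ρ (packet k X)) := by
  obtain ⟨hJρ, hs, hp, hF⟩ := hρ
  by_cases hfull : packet k X ∩ J = packet k X
  · refine (hF X ⟨hX, hfull⟩).imp (fun h => ⟨?_, h⟩) fun h => ⟨?_, h⟩ <;>
    · rw [hfull]
      exact ⟨subset_rfl, fun U hU _ _ _ => hU⟩
  by_cases hempty : packet k X ∩ J = ∅
  · refine Or.inl ⟨?_, ?_⟩
    · rw [hempty]
      exact ⟨Finset.empty_subset _, fun U _ V hV => absurd hV (Finset.notMem_empty V)⟩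
    · rw [inducesLex_iff hJρ.1]
      intro A hA B _ hAX
      have : A ∈ packet k X ∩ J := Finset.mem_inter.2 ⟨hAX, (hJρ.2 A).1 hA⟩
      exact absurd (hempty ▸ this) (Finset.notMem_empty A)
  · exact (hJ.2 X hX).imp (fun h => ⟨h, hp X ⟨hX, h, hempty, hfull⟩⟩)
      fun h => ⟨h, hs X ⟨hX, h, hempty, hfull⟩⟩

theorem mem_toFinset_take {A B : Finset (Fin n)} {i : ℕ} (hB : B ∈ (ρ.take i).toFinset)
    (hA : A ∈ ρ) (h : Before ρ A B) : A ∈ (ρ.take i).toFinset := by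
  rw [List.mem_toFinset] at hB ⊢
  rw [List.mem_take_iff_idxOf_lt (List.mem_of_mem_take hB)] at hB
  exact (List.mem_take_iff_idxOf_lt hA).2 (h.trans hB)

/-- The initial segments of an admissible order are realizable. -/
theorem realizable_take (hJ : Realizable k J) (hρ : ρ ∈ AJ n k J) (i : ℕ) :
    Realizable k (ρ.take i).toFinset := by
  have hsub : ∀ A ∈ (ρ.take i).toFinset, A ∈ ρ ∧ A ∈ J := fun A hA =>
    have := List.mem_of_mem_take (List.mem_toFinset.1 hA)
    ⟨this, (hρ.1.2 A).1 this⟩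
  refine ⟨fun A hA => hJ.1 (hsub A hA).2, fun X hX => ?_⟩
  refine (isPrefix_and_inducesLex_or hJ hρ hX).imp ?_ ?_ <;>
  · rintro ⟨hseg, hind⟩
    refine ⟨Finset.inter_subset_left, fun A hA B hB hAB => ?_⟩
    rw [Finset.mem_inter] at hB ⊢
    refine ⟨hA, ?_⟩
    obtain ⟨hBρ, hBJ⟩ := hsub B hB.2
    have hAρ := (hρ.1.2 A).2 (Finset.mem_inter.1
      (hseg.2 A hA B (Finset.mem_inter.2 ⟨hB.1, hBJ⟩) hAB)).2
    by_cases hne : A = B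
    · exact hne ▸ hB.2
    rcases before_or_before hAρ hne with h | h
    · exact mem_toFinset_take hB.2 hAρ h
    · first
        | rw [inducesLex_iff hρ.1.1] at hind
          exact absurd (hind B hBρ A hAρ hB.1 hA h) (not_lexLT_of_lexLT hX hA hB.1 hAB)
        | rw [inducesAntilex_iff hρ.1.1] at hind
          exact absurd (hind B hBρ A hAρ hB.1 hA h) (not_lexLT_of_lexLT hX hB.1 hA hAB)

/-- An order all of whose initial segments are realizable is admissible. -/
theorem mem_AJ_of_realizable_take (hρ : IsTotalOrderOn ρ J)
    (h : ∀ i, Realizable k (ρ.take i).toFinset) : ρ ∈ AJ n k J := by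
  -- Realizability at the cut just after `E`, hence the length `ρ.idxOf E + 1`: the packet members
  -- up to and including `E` form an initial or a final segment.
  have seg : ∀ X ∈ C n (k + 1), ∀ E ∈ ρ,
      (∀ A ∈ packet k X, ∀ B ∈ packet k X, LexLT A B → B ∈ ρ → ρ.idxOf B ≤ ρ.idxOf E →
        A ∈ ρ ∧ ρ.idxOf A ≤ ρ.idxOf E) ∨
      (∀ A ∈ packet k X, ∀ B ∈ packet k X, LexLT B A → B ∈ ρ → ρ.idxOf B ≤ ρ.idxOf E →
        A ∈ ρ ∧ ρ.idxOf A ≤ ρ.idxOf E) := by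
    intro X hX E hE
    refine ((h (ρ.idxOf E + 1)).2 X hX).imp ?_ ?_ <;>
    · intro hseg A hA B hB hAB hBρ hBE
      have hBT : B ∈ ρ.take (ρ.idxOf E + 1) :=
        (List.mem_take_iff_idxOf_lt hBρ).2 (Nat.lt_succ_of_le hBE)
      have := hseg.2 A hA B (Finset.mem_inter.2 ⟨hB, List.mem_toFinset.2 hBT⟩) hAB
      have hAT := List.mem_toFinset.1 (Finset.mem_inter.1 this).2
      have hAρ := List.mem_of_mem_take hAT
      exact ⟨hAρ, Nat.le_of_lt_succ ((List.mem_take_iff_idxOf_lt hAρ).1 hAT)⟩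
  have tri : ∀ {X A B}, X ∈ C n (k + 1) → A ∈ packet k X → B ∈ packet k X →
      Before ρ A B → LexLT A B ∨ LexLT B A := by
    intro X A B hX hA hB hAB
    rcases lexLT_or_eq_or_lexLT hX hA hB with h | rfl | h
    · exact Or.inl h
    · exact absurd hAB (lt_irrefl _)
    · exact Or.inr h
  have notMem : ∀ {X : Finset (Fin n)}, packet k X ∩ J ≠ packet k X →
      ∃ W ∈ packet k X, W ∉ J := by
    intro X hne
    by_contra hc
    push Not at hc
    exact hne (Finset.inter_eq_left.2 hc)
  refine ⟨hρ, ?_, ?_, ?_⟩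
  · rintro X ⟨hX, hsuf, -, hne⟩
    rw [inducesAntilex_iff hρ.1]
    intro A hA B hB hAX hBX hAB
    refine (tri hX hAX hBX hAB).resolve_left fun hlex => ?_
    -- At the cut after `A` the lexicographically larger `B` is missing, so the segment is initial.
    -- Together with the final segment cut out by `J` it would cover the whole packet, including
    -- some `W` outside `J`.
    rcases seg X hX A hA with hs | hs
    · obtain ⟨W, hW, hWJ⟩ := notMem hne
      rcases lexLT_or_eq_or_lexLT hX hW hAX with h' | rfl | h'
      · exact hWJ ((hρ.2 W).1 (hs W hW A hAX h' hA le_rfl).1)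
      · exact hWJ ((hρ.2 W).1 hA)
      · exact hWJ (Finset.mem_inter.1 (hsuf.2 W hW A
          (Finset.mem_inter.2 ⟨hAX, (hρ.2 A).1 hA⟩) h')).2
    · exact absurd (hs B hBX A hAX hlex hA le_rfl).2 (not_le.2 hAB)
  · rintro X ⟨hX, hpre, -, hne⟩
    rw [inducesLex_iff hρ.1]
    intro A hA B hB hAX hBX hAB
    refine (tri hX hAX hBX hAB).resolve_right fun hlex => ?_
    rcases seg X hX A hA with hs | hs
    · exact absurd (hs B hBX A hAX hlex hA le_rfl).2 (not_le.2 hAB)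
    · obtain ⟨W, hW, hWJ⟩ := notMem hne
      rcases lexLT_or_eq_or_lexLT hX hW hAX with h' | rfl | h'
      · exact hWJ (Finset.mem_inter.1 (hpre.2 W hW A
          (Finset.mem_inter.2 ⟨hAX, (hρ.2 A).1 hA⟩) h')).2
      · exact hWJ ((hρ.2 W).1 hA)
      · exact hWJ ((hρ.2 W).1 (hs W hW A hAX h' hA le_rfl).1)
  · rintro X ⟨hX, -⟩
    rw [inducesLex_iff hρ.1, inducesAntilex_iff hρ.1]
    by_contra hc
    push Not at hc
    obtain ⟨⟨A, hA, B, hB, hAX, hBX, hAB, hlex⟩, A', hA', B', hB', hAX', hBX', hAB', hlex'⟩ := hc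
    replace hlex := (tri hX hAX hBX hAB).resolve_left hlex
    replace hlex' := (tri hX hAX' hBX' hAB').resolve_right hlex'
    -- The cut after `A` yields a final segment and the cut after `A'` an initial one. At the later
    -- of the two cuts, the element still to come (`B'` or `B`) is already included by one of these
    -- segments.
    have hs := (seg X hX A hA).resolve_left fun hs =>
      absurd (hs B hBX A hAX hlex hA le_rfl).2 (not_le.2 hAB)
    have hs' := (seg X hX A' hA').resolve_right fun hs =>
      absurd (hs B' hBX' A' hAX' hlex' hA' le_rfl).2 (not_le.2 hAB')
    rcases le_total (ρ.idxOf A) (ρ.idxOf A') with hle | hle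
    · refine absurd hAB' (not_lt.2 ?_)
      rcases lexLT_or_eq_or_lexLT hX hAX hBX' with h' | rfl | h'
      · exact (hs B' hBX' A hAX h' hA le_rfl).2.trans hle
      · exact hle
      · exact (hs' B' hBX' A hAX h' hA hle).2
    · refine absurd hAB (not_lt.2 ?_)
      rcases lexLT_or_eq_or_lexLT hX hAX' hBX with h' | rfl | h'
      · exact (hs B hBX A' hAX' h' hA' hle).2
      · exact hle
      · exact (hs' B hBX A' hAX' h' hA' le_rfl).2.trans hle

end AdmissibleOrders

/-! ### Paths and their label sequences -/

section LabelledPaths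

variable {n j : ℕ}

theorem exists_hasLabels (γ : RelSeries (Step n j)) : ∃ ρ, HasLabels γ ρ := by
  choose X hX using γ.step
  refine ⟨List.ofFn X, List.length_ofFn.symm, fun i => ?_⟩
  simpa using hX i

theorem FlipUp.label_unique (hj : 1 ≤ j) {r r' : B n j} {X Y : Finset (Fin n)}
    (hX : FlipUp r X r') (hY : FlipUp r Y r') : X = Y := by
  have h := (hX.Inv_eq hj).symm.trans (hY.Inv_eq hj)
  exact (Finset.mem_insert.1 (h ▸ Finset.mem_insert_self X _)).resolve_right hX.2.1

theorem HasLabels.unique (hj : 1 ≤ j) {γ : RelSeries (Step n j)}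
    {ρ ρ' : List (Finset (Fin n))} (h : HasLabels γ ρ) (h' : HasLabels γ ρ') : ρ = ρ' := by
  obtain ⟨e, h⟩ := h
  obtain ⟨e', h'⟩ := h'
  refine List.ext_get (e.symm.trans e') fun i hi hi' => ?_
  exact (h ⟨i, e ▸ hi⟩).label_unique hj (h' ⟨i, e ▸ hi⟩)

/-- Each arrow adds its label to the inversion set, so the labels determine every vertex of a path
starting at the empty set. -/
theorem HasLabels.Inv_eq (hj : 1 ≤ j) {γ : RelSeries (Step n j)} {ρ : List (Finset (Fin n))}
    (h : HasLabels γ ρ) (h₀ : Inv γ.head = ∅) (i : ℕ) (hi : i < γ.length + 1) :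
    Inv (γ ⟨i, hi⟩) = (ρ.take i).toFinset := by
  obtain ⟨e, h⟩ := h
  induction i with
  | zero => exact h₀
  | succ i ih =>
    have hi' : i < γ.length := Nat.lt_of_succ_lt_succ hi
    have := (h ⟨i, hi'⟩).Inv_eq hj
    rw [show (⟨i, hi'⟩ : Fin γ.length).castSucc = ⟨i, Nat.lt_succ_of_lt hi'⟩ from rfl, ih] at this
    rw [List.take_succ_eq_append_getElem (e ▸ hi'), List.toFinset_append]
    refine this.trans ?_
    ext A
    simp [or_comm]

theorem HasLabels.isTotalOrderOn (hj : 1 ≤ j) {γ : RelSeries (Step n j)}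
    {ρ : List (Finset (Fin n))} (h : HasLabels γ ρ) (h₀ : Inv γ.head = ∅) :
    IsTotalOrderOn ρ (Inv γ.last) := by
  have hInv := h.Inv_eq hj h₀
  obtain ⟨e, h⟩ := h
  constructor
  · refine List.pairwise_iff_getElem.2 fun i l hi hl hil heq => ?_
    refine (h ⟨l, e ▸ hl⟩).2.1 ?_
    rw [show (⟨l, e ▸ hl⟩ : Fin γ.length).castSucc = ⟨l, Nat.lt_succ_of_lt (e ▸ hl)⟩ from rfl,
      hInv, List.mem_toFinset]
    change ρ[l] ∈ _
    rw [← heq, List.mem_take_iff_getElem]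
    exact ⟨i, by omega, rfl⟩
  · intro A
    rw [show γ.last = γ ⟨γ.length, Nat.lt_succ_self _⟩ from rfl, hInv, e, List.take_length,
      List.mem_toFinset]

theorem HasLabels.mem_AJ (hj : 1 ≤ j) {γ : RelSeries (Step n j)}
    {ρ : List (Finset (Fin n))} (h : HasLabels γ ρ) (h₀ : Inv γ.head = ∅) :
    ρ ∈ AJ n (j + 1) (Inv γ.last) := by
  refine mem_AJ_of_realizable_take (h.isTotalOrderOn hj h₀) fun i => ?_
  by_cases hi : i < γ.length + 1
  · rw [← h.Inv_eq hj h₀ i hi]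
    exact realizable_Inv _
  -- Beyond the end of the path `take` returns all of `ρ`, the inversion set of the last vertex.
  · have := h.Inv_eq hj h₀ γ.length (Nat.lt_succ_self _)
    have e := h.1
    rw [List.take_of_length_le (by omega)] at this ⊢
    exact this ▸ realizable_Inv _

theorem HasLabels.eq (hj : 1 ≤ j) {γ γ' : RelSeries (Step n j)} {ρ : List (Finset (Fin n))}
    (h : HasLabels γ ρ) (h' : HasLabels γ' ρ) (h₀ : Inv γ.head = ∅) (h₀' : Inv γ'.head = ∅) :
    γ = γ' := by
  refine RelSeries.ext (h.1.trans h'.1.symm) (funext fun i => Inv_injective ?_)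
  exact (h.Inv_eq hj h₀ i i.2).trans (h'.Inv_eq hj h₀' i _).symm

theorem exists_path_of_realizable_take (hj : 1 ≤ j) {ρ : List (Finset (Fin n))} (hρ : ρ.Nodup)
    (h : ∀ i, Realizable (j + 1) (ρ.take i).toFinset) :
    ∃ γ : RelSeries (Step n j),
      Inv γ.head = ∅ ∧ Inv γ.last = ρ.toFinset ∧ HasLabels γ ρ := by
  -- The vertices are forced: the `i`-th one has the first `i` labels as its inversion set.
  choose r hr using fun i => exists_Inv_eq hj (h i)
  have hflip : ∀ i : Fin ρ.length, FlipUp (r i) (ρ.get i) (r (i + 1)) := by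
    intro i
    refine exists_flipUp hj ?_ ?_
    · rw [hr, List.mem_toFinset, List.mem_take_iff_getElem]
      rintro ⟨l, hl, e⟩
      have := (hρ.getElem_inj_iff (hi := by omega) (hj := i.2)).1 e
      omega
    · rw [hr, hr, List.take_succ_eq_append_getElem i.2, List.toFinset_append]
      ext A
      simp [or_comm]
  refine ⟨⟨ρ.length, fun i => r i, fun i => ⟨ρ.get i, hflip i⟩⟩, ?_, ?_, rfl, hflip⟩
  · change Inv (r 0) = ∅
    simp [hr]
  · change Inv (r ρ.length) = _
    simp [hr]

end LabelledPaths

end HigherBruhat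

/-- For `k > 1` and a realizable `k`-set `J`, sending a path from `∅` to `J` in `B(n,k-1)` to the
total order in which its labels occur is a well-defined bijection from the set of these paths
onto the set of admissible `J`-orders. -/
theorem mainTheorem4 (n k : ℕ) (hk : 1 < k) (J : Finset (Finset (Fin n)))
    (hJ : HigherBruhat.Realizable k J) :
    ∃ Φ : HigherBruhat.Paths n (k - 1) ∅ J ≃ HigherBruhat.AJ n k J,
      ∀ (γ : HigherBruhat.Paths n (k - 1) ∅ J) (ρ : List (Finset (Fin n))),
        HigherBruhat.HasLabels γ.1 ρ ↔ ρ = (Φ γ).1 := by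
  obtain ⟨j, rfl⟩ : ∃ j, k = j + 1 := ⟨k - 1, by omega⟩
  have hj : 1 ≤ j := by omega
  rw [Nat.add_sub_cancel]
  choose L hL using fun γ : HigherBruhat.Paths n j ∅ J => HigherBruhat.exists_hasLabels γ.1
  have hLJ : ∀ γ, L γ ∈ HigherBruhat.AJ n (j + 1) J := fun γ => by
    have := (hL γ).mem_AJ hj γ.2.1
    rwa [γ.2.2] at this
  refine ⟨Equiv.ofBijective (fun γ => ⟨L γ, hLJ γ⟩) ⟨fun γ γ' h => ?_, fun ρ => ?_⟩,
    fun γ ρ => ⟨fun h => h.unique hj (hL γ), ?_⟩⟩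
  · have e : L γ = L γ' := congrArg Subtype.val h
    exact Subtype.ext ((hL γ).eq hj (e ▸ hL γ') γ.2.1 γ'.2.1)
  · obtain ⟨γ, h₀, h₁, hγ⟩ := HigherBruhat.exists_path_of_realizable_take hj ρ.2.1.1
      (HigherBruhat.realizable_take hJ ρ.2)
    have h₂ : ρ.1.toFinset = J := by
      ext A
      rw [List.mem_toFinset]
      exact ρ.2.1.2 A
    exact ⟨⟨γ, h₀, h₁.trans h₂⟩, Subtype.ext ((hL _).unique hj hγ)⟩
  · rintro rfl
    exact hL γ
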